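/- Let $k$ be a field, let $n, d \ge 2$ be integers, and let $R = k[s, f, b_{ri}, c_{ri} \mid r = 0, \ldots, n-1;\ i = 1, 2, 3, 4]$ be the polynomial ring in $8n+2$ variables. Define the following ideals of $R$: $$ \begin{aligned} E &= (s - f b_{01}^d,\ b_{01} - b_{04},\ b_{02}^d - b_{03}^d,\ b_{01}^d - b_{02}^d),\\ F &= (b_{02} - b_{11} b_{03},\ b_{14} - b_{11},\ b_{13} - b_{11},\ b_{12} - b_{11},\ b_{12}^d - 1),\\ C_r &= (c_{r1}, c_{r2}, c_{r3}, c_{r4}) \quad (0 \le r \le n-1), \qquad C_n = (0),\\ D_0 &= (c_{04} - c_{01},\ c_{03} - c_{02},\ c_{01} - c_{02} b_{01}^d),\\ D_r &= (c_{r4} - c_{r1},\ c_{r3} - c_{r2},\ c_{r2} - c_{r1}) \quad (1 \le r \le n-1), \qquad D_n = (0),\\ B_0 &= B_1 = (0), \qquad B_r = (1 - b_{ji} \mid 2 \le j \le r,\ 1 \le i \le 4) \quad (2 \le r \le n-1), \end{aligned} $$ and set $$ p_1 = C_1 + E + D_0, \qquad p_r = C_r + E + F + B_{r-1} + D_0 +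 D_1 + \cdots + D_{r-1} \quad (2 \le r \le n). $$ Then for every $r$ with $2 \le r \le n$, $$ p_1 \cap p_2 \cap \cdots \cap p_r = E + D_0 + C_1 F + \sum_{i=0}^{r-1} C_1 C_2 \cdots C_i \,(D_{i+1} + B_i) + C_1 C_2 \cdots C_r, $$ where the empty product $C_1 \cdots C_i$ for $i = 0$ is $R$. -/

import Mathlib

namespace MayrMeyer

/-- The `8n+2` variables `s, f, b_{ri}, c_{ri}` with `r = 0, …, n-1` and `i = 1, …, 4`.
The second subscript is shifted by one: `b r 0, b r 1, b r 2, b r 3` stand for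
`b_{r1}, b_{r2}, b_{r3}, b_{r4}`, and likewise for `c`. -/
inductive Var (n : ℕ) : Type
  | s : Var n
  | f : Var n
  | b (r : Fin n) (i : Fin 4) : Var n
  | c (r : Fin n) (i : Fin 4) : Var n

/-- The polynomial ring `R = k[s, f, b_{ri}, c_{ri}]`. -/
abbrev PolyRing (k : Type*) [Field k] (n : ℕ) : Type _ := MvPolynomial (Var n) k

/-- The variable `s`. -/
noncomputable def s (k : Type*) [Field k] (n : ℕ) : PolyRing k n := MvPolynomial.X Var.s

/-- The variable `f`. -/
noncomputable def f (k : Type*) [Field k] (n : ℕ) : PolyRing k n := MvPolynomial.X Var.f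

/-- The variable `b_{r,i+1}`. -/
noncomputable def b (k : Type*) [Field k] {n : ℕ} (r : Fin n) (i : Fin 4) : PolyRing k n :=
  MvPolynomial.X (Var.b r i)

/-- The variable `c_{r,i+1}`. -/
noncomputable def c (k : Type*) [Field k] {n : ℕ} (r : Fin n) (i : Fin 4) : PolyRing k n :=
  MvPolynomial.X (Var.c r i)

/-- The level `0`, as an element of `Fin n`. -/
def lev0 {n : ℕ} (hn : 2 ≤ n) : Fin n := ⟨0, by omega⟩

/-- The level `1`, as an element of `Fin n`. -/
def lev1 {n : ℕ} (hn : 2 ≤ n) : Fin n := ⟨1, by omega⟩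

/-- `E = (s - f b₀₁^d, b₀₁ - b₀₄, b₀₂^d - b₀₃^d, b₀₁^d - b₀₂^d)`. -/
noncomputable def idealE (k : Type*) [Field k] {n : ℕ} (hn : 2 ≤ n) (d : ℕ) :
    Ideal (PolyRing k n) :=
  Ideal.span
    {s k n - f k n * b k (lev0 hn) 0 ^ d,
     b k (lev0 hn) 0 - b k (lev0 hn) 3,
     b k (lev0 hn) 1 ^ d - b k (lev0 hn) 2 ^ d,
     b k (lev0 hn) 0 ^ d - b k (lev0 hn) 1 ^ d}

/-- `F = (b₀₂ - b₁₁ b₀₃, b₁₄ - b₁₁, b₁₃ - b₁₁, b₁₂ - b₁₁, b₁₂^d - 1)`. -/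
noncomputable def idealF (k : Type*) [Field k] {n : ℕ} (hn : 2 ≤ n) (d : ℕ) :
    Ideal (PolyRing k n) :=
  Ideal.span
    {b k (lev0 hn) 1 - b k (lev1 hn) 0 * b k (lev0 hn) 2,
     b k (lev1 hn) 3 - b k (lev1 hn) 0,
     b k (lev1 hn) 2 - b k (lev1 hn) 0,
     b k (lev1 hn) 1 - b k (lev1 hn) 0,
     b k (lev1 hn) 1 ^ d - 1}

/-- `C_r = (c_{r1}, c_{r2}, c_{r3}, c_{r4})` for `r = 0, …, n-1`, and `C_n = (0)`. -/
noncomputable def idealC (k : Type*) [Field k] (n : ℕ) (r : ℕ) : Ideal (PolyRing k n) :=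
  if h : r < n then Ideal.span {c k ⟨r, h⟩ 0, c k ⟨r, h⟩ 1, c k ⟨r, h⟩ 2, c k ⟨r, h⟩ 3}
  else ⊥

/-- `D_0 = (c₀₄ - c₀₁, c₀₃ - c₀₂, c₀₁ - c₀₂ b₀₁^d)`,
`D_r = (c_{r4} - c_{r1}, c_{r3} - c_{r2}, c_{r2} - c_{r1})` for `r = 1, …, n-1`,
and `D_n = (0)`. -/
noncomputable def idealD (k : Type*) [Field k] {n : ℕ} (hn : 2 ≤ n) (d : ℕ) (r : ℕ) :
    Ideal (PolyRing k n) :=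
  if r = 0 then
    Ideal.span
      {c k (lev0 hn) 3 - c k (lev0 hn) 0,
       c k (lev0 hn) 2 - c k (lev0 hn) 1,
       c k (lev0 hn) 0 - c k (lev0 hn) 1 * b k (lev0 hn) 0 ^ d}
  else if h : r < n then
    Ideal.span
      {c k ⟨r, h⟩ 3 - c k ⟨r, h⟩ 0,
       c k ⟨r, h⟩ 2 - c k ⟨r, h⟩ 1,
       c k ⟨r, h⟩ 1 - c k ⟨r, h⟩ 0}
  else ⊥

/-- `B_r = (1 - b_{ji} : 2 ≤ j ≤ r, 1 ≤ i ≤ 4)` for `r = 0, …, n-1`; in particular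
`B_0 = B_1 = (0)`. -/
noncomputable def idealB (k : Type*) [Field k] (n : ℕ) (r : ℕ) : Ideal (PolyRing k n) :=
  Ideal.span {x | ∃ (j : Fin n) (i : Fin 4), 2 ≤ (j : ℕ) ∧ (j : ℕ) ≤ r ∧ x = 1 - b k j i}

/-- `p_1 = C_1 + E + D_0` and, for `r = 2, …, n`,
`p_r = C_r + E + F + B_{r-1} + D_0 + D_1 + ⋯ + D_{r-1}`. (Also `p_0 = C_0`, which is not used.) -/
noncomputable def idealP (k : Type*) [Field k] {n : ℕ} (hn : 2 ≤ n) (d : ℕ) :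
    ℕ → Ideal (PolyRing k n)
  | 0 => idealC k n 0
  | 1 => idealC k n 1 + idealE k hn d + idealD k hn d 0
  | r + 2 => idealC k n (r + 2) + idealE k hn d + idealF k hn d + idealB k n (r + 1)
      + ∑ j ∈ Finset.range (r + 2), idealD k hn d j

end MayrMeyer

namespace MayrMeyer

/-! Induct on r. Let K_r (`commonPart`) be the right-hand side without its last term C_1⋯C_r. For r
≥ 1, K_r lies in p_{r+1}, so in the modular law only C_1⋯C_r has to be intersected with p_{r+1}.
Modulo K_r that product is generated by the single element m = c_{11}⋯c_{r1}, because D_j identifies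
the four variables c_{ji} (`prodC_le_span_add_commonPart`). Each c_{j1} with 1 ≤ j ≤ r is a
nonzerodivisor modulo p_{r+1} (`mem_idealP_of_c_mul_mem`), so the intersection is K_r + m p_{r+1}.
Multiplying this out summand by summand lands in K_{r+1} + C_1⋯C_{r+1} (`span_prod_mul_idealP_le`),
and the reverse inclusion is direct. -/

open MvPolynomial

variable {k : Type*} [Field k] {n : ℕ}

/-! ### Each c_{j1} is a nonzerodivisor modulo the later p_r. -/

section NonZeroDivisor

/-- The endomorphism sending each `c_{ji}` to `c_{j1}` and fixing the other variables. -/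
noncomputable def collapse (k : Type*) [Field k] {n : ℕ} (j : Fin n) :
    PolyRing k n →ₐ[k] PolyRing k n :=
  open Classical in aeval fun v => if ∃ i, v = Var.c j i then c k j 0 else X v

theorem collapse_c (j : Fin n) (i : Fin 4) : collapse k j (c k j i) = c k j 0 := by
  simp [collapse, c]

theorem collapse_of_mem_supported {j : Fin n} {t : PolyRing k n}
    (ht : t ∈ supported k {v : Var n | ∀ i, v ≠ Var.c j i}) : collapse k j t = t := by
  induction ht using Algebra.adjoin_induction with
  | mem x hx =>
    obtain ⟨v, hv, rfl⟩ := hx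
    have : ¬ ∃ i, v = Var.c j i := fun ⟨i, hi⟩ => hv i hi
    simp [collapse, this]
  | algebraMap a => simp
  | add x y _ _ hx hy => rw [map_add, hx, hy]
  | mul x y _ _ hx hy => rw [map_mul, hx, hy]

theorem sub_collapse_mem {j : Fin n} {I : Ideal (PolyRing k n)}
    (hI : ∀ i, c k j i - c k j 0 ∈ I) (x : PolyRing k n) : x - collapse k j x ∈ I := by
  induction x using MvPolynomial.induction_on with
  | C a => simp [collapse, ← algebraMap_eq]
  | add p q hp hq =>
    rw [map_add, add_sub_add_comm]
    exact I.add_mem hp hq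
  | mul_X p v hp =>
    have hv : X v - collapse k j (X v) ∈ I := by
      by_cases h : ∃ i, v = Var.c j i
      · obtain ⟨i, rfl⟩ := h
        have := collapse_c (k := k) j i
        rw [c] at this
        rw [this]
        exact hI i
      · simp [collapse, h]
    rw [map_mul, show p * X v - collapse k j p * collapse k j (X v)
      = X v * (p - collapse k j p) + collapse k j p * (X v - collapse k j (X v)) by ring]
    exact I.add_mem (I.mul_mem_left _ hp) (I.mul_mem_left _ hv)

/-- `divMonomial` discards the terms not divisible by v, and a factor free of v does not change
which terms those are. -/
theorem divMonomial_single_mul_of_mem_supported {σ R : Type*} [CommSemiring R] {v : σ}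
    {s : Set σ} (hv : v ∉ s) {t : MvPolynomial σ R} (ht : t ∈ supported R s)
    (y : MvPolynomial σ R) :
    (y * t).divMonomial (Finsupp.single v 1) = y.divMonomial (Finsupp.single v 1) * t := by
  classical
  induction ht using Algebra.adjoin_induction generalizing y with
  | mem x hx =>
    obtain ⟨w, hw, rfl⟩ := hx
    have hne : w ≠ v := fun h => hv (h ▸ hw)
    ext m
    rw [coeff_divMonomial, coeff_mul_X', coeff_mul_X', coeff_divMonomial]
    have hmem : w ∈ (Finsupp.single v 1 + m).support ↔ w ∈ m.support := by
      simp [hne.symm]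
    by_cases h : w ∈ m.support
    · rw [if_pos (hmem.2 h), if_pos h, add_tsub_assoc_of_le]
      rw [Finsupp.single_le_iff]
      exact Nat.one_le_iff_ne_zero.2 (Finsupp.mem_support_iff.1 h)
    · rw [if_neg (fun h' => h (hmem.1 h')), if_neg h]
  | algebraMap a =>
    ext m
    simp [algebraMap_eq, mul_comm _ (C a), coeff_divMonomial]
  | add p q _ _ hp hq => rw [mul_add, add_divMonomial, hp, hq, mul_add]
  | mul p q _ _ hp hq => rw [← mul_assoc, hq, hp, mul_assoc]

/-- Stability of an ideal under collapsing the variables `c_{ji}` and dividing by `c_{j1}`. -/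
def StableUnderDiv (j : Fin n) (I : Ideal (PolyRing k n)) : Prop :=
  ∀ x ∈ I, ∀ y, (collapse k j x * y).divMonomial (Finsupp.single (Var.c j 0) 1) ∈ I

theorem StableUnderDiv.add {j : Fin n} {I J : Ideal (PolyRing k n)} (hI : StableUnderDiv j I)
    (hJ : StableUnderDiv j J) : StableUnderDiv j (I + J) := by
  intro x hx y
  obtain ⟨u, hu, v, hv, rfl⟩ := Submodule.mem_sup.1 hx
  rw [map_add, add_mul, add_divMonomial]
  exact Submodule.add_mem_sup (hI u hu y) (hJ v hv y)

theorem StableUnderDiv.span {j : Fin n} {T : Set (PolyRing k n)}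
    (hT : ∀ t ∈ T, t ∈ supported k {v : Var n | ∀ i, v ≠ Var.c j i} ∨ collapse k j t = 0) :
    StableUnderDiv j (Ideal.span T) := by
  intro x hx
  induction hx using Submodule.span_induction with
  | zero => simp
  | add p q _ _ hp hq =>
    intro y
    rw [map_add, add_mul, add_divMonomial]
    exact Ideal.add_mem _ (hp y) (hq y)
  | smul a p _ hp =>
    intro y
    -- The collapsed coefficient is absorbed into y; this is why stability quantifies over a
    -- multiplier.
    rw [smul_eq_mul, map_mul, mul_comm (collapse k j a), mul_assoc]
    exact hp _
  | mem t ht =>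
    intro y
    rcases hT t ht with h | h
    · rw [collapse_of_mem_supported h, mul_comm,
        divMonomial_single_mul_of_mem_supported (by simp) h]
      exact Ideal.mul_mem_left _ _ (Ideal.subset_span ht)
    · simp [h]

theorem StableUnderDiv.sum {j : Fin n} {ι : Type*} {A : Finset ι}
    {I : ι → Ideal (PolyRing k n)} (hI : ∀ i ∈ A, StableUnderDiv j (I i)) :
    StableUnderDiv j (∑ i ∈ A, I i) :=
  Finset.sum_induction _ _ (fun _ _ => StableUnderDiv.add)
    (by rintro x rfl; simp) hI

/-- Collapsing c_{j1} a and dividing by c_{j1} leaves the collapse of a, which is congruent to a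
modulo I. -/
theorem StableUnderDiv.mem_of_c_mul_mem {j : Fin n} {I : Ideal (PolyRing k n)}
    (hI : StableUnderDiv j I) (hc : ∀ i, c k j i - c k j 0 ∈ I) {a : PolyRing k n}
    (ha : c k j 0 * a ∈ I) : a ∈ I := by
  have h := hI _ ha 1
  rw [mul_one, map_mul, collapse_c, c, X_mul_divMonomial] at h
  simpa using I.add_mem (sub_collapse_mem hc a) h

theorem b_mem_supported (j r : Fin n) (i : Fin 4) :
    b k r i ∈ supported k {v : Var n | ∀ i, v ≠ Var.c j i} := by
  simp [b]

theorem c_mem_supported {j r : Fin n} (h : r ≠ j) (i : Fin 4) :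
    c k r i ∈ supported k {v : Var n | ∀ i, v ≠ Var.c j i} := by
  simp [c, h]

theorem s_mem_supported (j : Fin n) :
    s k n ∈ supported k {v : Var n | ∀ i, v ≠ Var.c j i} := by
  simp [s]

theorem f_mem_supported (j : Fin n) :
    f k n ∈ supported k {v : Var n | ∀ i, v ≠ Var.c j i} := by
  simp [f]

theorem stableUnderDiv_idealE (hn : 2 ≤ n) (d : ℕ) (j : Fin n) :
    StableUnderDiv j (idealE k hn d) := by
  refine StableUnderDiv.span fun t ht => Or.inl ?_
  have hb := b_mem_supported (k := k) j
  rcases ht with rfl | rfl | rfl | rfl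
  · exact sub_mem (s_mem_supported j) (mul_mem (f_mem_supported j) (pow_mem (hb _ _) _))
  · exact sub_mem (hb _ _) (hb _ _)
  · exact sub_mem (pow_mem (hb _ _) _) (pow_mem (hb _ _) _)
  · exact sub_mem (pow_mem (hb _ _) _) (pow_mem (hb _ _) _)

theorem stableUnderDiv_idealF (hn : 2 ≤ n) (d : ℕ) (j : Fin n) :
    StableUnderDiv j (idealF k hn d) := by
  refine StableUnderDiv.span fun t ht => Or.inl ?_
  have hb := b_mem_supported (k := k) j
  rcases ht with rfl | rfl | rfl | rfl | rfl
  · exact sub_mem (hb _ _) (mul_mem (hb _ _) (hb _ _))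
  · exact sub_mem (hb _ _) (hb _ _)
  · exact sub_mem (hb _ _) (hb _ _)
  · exact sub_mem (hb _ _) (hb _ _)
  · exact sub_mem (pow_mem (hb _ _) _) (one_mem _)

theorem stableUnderDiv_idealB (r : ℕ) (j : Fin n) : StableUnderDiv j (idealB k n r) := by
  refine StableUnderDiv.span ?_
  rintro t ⟨l, i, -, -, rfl⟩
  exact Or.inl (sub_mem (one_mem _) (b_mem_supported j l i))

theorem stableUnderDiv_bot (j : Fin n) : StableUnderDiv j (⊥ : Ideal (PolyRing k n)) := by
  rintro x rfl
  simp

theorem stableUnderDiv_idealC {r : ℕ} {j : Fin n} (h : r ≠ j) :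
    StableUnderDiv j (idealC k n r) := by
  unfold idealC
  split_ifs with hr
  · refine StableUnderDiv.span fun t ht => Or.inl ?_
    have hne : (⟨r, hr⟩ : Fin n) ≠ j := fun h' => h (congrArg Fin.val h')
    rcases ht with rfl | rfl | rfl | rfl <;> exact c_mem_supported hne _
  · exact stableUnderDiv_bot j

/-- The generators of D_j collapse to 0, and those of the other D_r are free of c_{ji}. Level j = 0
is excluded because c_{01} - c_{02} b_{01}^d satisfies neither condition. -/
theorem stableUnderDiv_idealD (hn : 2 ≤ n) (d r : ℕ) {j : Fin n} (hj : 1 ≤ (j : ℕ)) :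
    StableUnderDiv j (idealD k hn d r) := by
  have hb := b_mem_supported (k := k) j
  unfold idealD
  split_ifs with h0 hr
  · have hne : lev0 hn ≠ j := by
      rintro rfl
      exact absurd hj (by simp [lev0])
    have hc := c_mem_supported (k := k) hne
    refine StableUnderDiv.span fun t ht => Or.inl ?_
    rcases ht with rfl | rfl | rfl
    · exact sub_mem (hc _) (hc _)
    · exact sub_mem (hc _) (hc _)
    · exact sub_mem (hc _) (mul_mem (hc _) (pow_mem (hb _ _) _))
  · refine StableUnderDiv.span fun t ht => ?_
    by_cases h : (⟨r, hr⟩ : Fin n) = j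
    · right
      rw [h] at ht
      rcases ht with rfl | rfl | rfl <;> simp [collapse_c]
    · left
      have hc := c_mem_supported (k := k) h
      rcases ht with rfl | rfl | rfl <;> exact sub_mem (hc _) (hc _)
  · exact stableUnderDiv_bot j

theorem c_sub_c_mem_idealD (hn : 2 ≤ n) (d : ℕ) {r : ℕ} (hr : 1 ≤ r) (hrn : r < n) (i : Fin 4) :
    c k ⟨r, hrn⟩ i - c k ⟨r, hrn⟩ 0 ∈ idealD k hn d r := by
  rw [idealD, if_neg (by omega), dif_pos hrn]
  have h1 : c k ⟨r, hrn⟩ 1 - c k ⟨r, hrn⟩ 0 ∈ Ideal.span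
      {c k ⟨r, hrn⟩ 3 - c k ⟨r, hrn⟩ 0, c k ⟨r, hrn⟩ 2 - c k ⟨r, hrn⟩ 1,
        c k ⟨r, hrn⟩ 1 - c k ⟨r, hrn⟩ 0} := Ideal.subset_span (by simp)
  fin_cases i
  · simp
  · exact h1
  · have h2 : c k ⟨r, hrn⟩ 2 - c k ⟨r, hrn⟩ 1 ∈ Ideal.span
        {c k ⟨r, hrn⟩ 3 - c k ⟨r, hrn⟩ 0, c k ⟨r, hrn⟩ 2 - c k ⟨r, hrn⟩ 1,
          c k ⟨r, hrn⟩ 1 - c k ⟨r, hrn⟩ 0} := Ideal.subset_span (by simp)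
    have h := Ideal.add_mem _ h2 h1
    rwa [sub_add_sub_cancel] at h
  · exact Ideal.subset_span (by simp)

theorem idealD_le_sum (hn : 2 ≤ n) (d : ℕ) {j r : ℕ} (hj : j < r) :
    idealD k hn d j ≤ ∑ l ∈ Finset.range r, idealD k hn d l :=
  Finset.single_le_sum (f := fun l => idealD k hn d l) (fun _ _ => bot_le)
    (Finset.mem_range.2 hj)

theorem mem_idealP_of_c_mul_mem (hn : 2 ≤ n) (d : ℕ) {r j : ℕ} (hj : 1 ≤ j) (hjr : j ≤ r + 1)
    (hjn : j < n) {a : PolyRing k n} (ha : c k ⟨j, hjn⟩ 0 * a ∈ idealP k hn d (r + 2)) :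
    a ∈ idealP k hn d (r + 2) := by
  refine StableUnderDiv.mem_of_c_mul_mem (j := ⟨j, hjn⟩) ?_ (fun i => ?_) ha
  -- Since j ≤ r + 1, the ideal C_{r+2} does not involve the variables c_{ji}.
  · exact ((((stableUnderDiv_idealC (by simp; omega)).add (stableUnderDiv_idealE hn d _)).add
      (stableUnderDiv_idealF hn d _)).add (stableUnderDiv_idealB _ _)).add
      (StableUnderDiv.sum fun l _ => stableUnderDiv_idealD hn d l hj)
  · exact (idealD_le_sum hn d (by omega)).trans le_sup_right
      (c_sub_c_mem_idealD hn d hj hjn i)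

end NonZeroDivisor

/-! ### Products of the C_j and their principal approximation. -/

/-- The variable `c_{j1}` for `j < n`, and `0` otherwise. -/
noncomputable def cHead (k : Type*) [Field k] (n j : ℕ) : PolyRing k n :=
  if h : j < n then c k ⟨j, h⟩ 0 else 0

theorem cHead_mem_idealC (j : ℕ) : cHead k n j ∈ idealC k n j := by
  unfold cHead idealC
  split_ifs
  · exact Ideal.subset_span (by simp)
  · exact zero_mem _

theorem idealC_le (hn : 2 ≤ n) (d : ℕ) {j : ℕ} (hj : 1 ≤ j) :
    idealC k n j ≤ Ideal.span {cHead k n j} + idealD k hn d j := by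
  by_cases h : j < n
  · have key (i : Fin 4) : c k ⟨j, h⟩ i ∈ Ideal.span {cHead k n j} + idealD k hn d j := by
      have := Submodule.add_mem_sup (Ideal.mem_span_singleton_self (cHead k n j))
        (c_sub_c_mem_idealD (k := k) hn d hj h i)
      simpa [cHead, h] using this
    rw [idealC, dif_pos h, Ideal.span_le]
    rintro t (rfl | rfl | rfl | rfl) <;> exact key _
  · simp [idealC, h]

theorem idealD_le_idealC (hn : 2 ≤ n) (d : ℕ) {j : ℕ} (hj : 1 ≤ j) :
    idealD k hn d j ≤ idealC k n j := by
  rw [idealD, if_neg (by omega), idealC]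
  split_ifs with h
  · have key (i : Fin 4) : c k ⟨j, h⟩ i ∈ Ideal.span
        {c k ⟨j, h⟩ 0, c k ⟨j, h⟩ 1, c k ⟨j, h⟩ 2, c k ⟨j, h⟩ 3} :=
      Ideal.subset_span (by fin_cases i <;> simp)
    rw [Ideal.span_le]
    rintro t (rfl | rfl | rfl) <;> exact sub_mem (key _) (key _)
  · exact le_rfl

theorem idealB_mono : Monotone (idealB k n) := by
  intro r t h
  refine Ideal.span_mono ?_
  rintro x ⟨j, i, h2, hr, hx⟩
  exact ⟨j, i, h2, hr.trans h, hx⟩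

theorem idealB_one : idealB k n 1 = ⊥ := by
  refine (Ideal.span_eq_bot).2 ?_
  rintro x ⟨j, i, h2, hr, -⟩
  omega

/-- The product `C_1 ⋯ C_r`. -/
noncomputable def prodC (k : Type*) [Field k] (n r : ℕ) : Ideal (PolyRing k n) :=
  ∏ j ∈ Finset.Icc 1 r, idealC k n j

theorem prodC_succ (r : ℕ) : prodC k n (r + 1) = prodC k n r * idealC k n (r + 1) :=
  Finset.prod_Icc_succ_top (by omega) _

theorem prodC_antitone : Antitone (prodC k n) :=
  antitone_nat_of_succ_le fun r => (prodC_succ (k := k) r).trans_le Ideal.mul_le_left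

theorem prodC_one : prodC k n 1 = idealC k n 1 := by
  simp [prodC]

/-- Trade the factors C_j for c_{j1} one at a time; each trade costs an error in C_1⋯C_{j-1} D_j. -/
theorem prodC_le_span_add (hn : 2 ≤ n) (d r : ℕ) :
    prodC k n r ≤ Ideal.span {∏ j ∈ Finset.Icc 1 r, cHead k n j}
      + ∑ i ∈ Finset.range r, prodC k n i * idealD k hn d (i + 1) := by
  induction r with
  | zero => simp [prodC, Ideal.one_eq_top]
  | succ r ih =>
    rw [Finset.sum_range_succ, Finset.prod_Icc_succ_top (by omega), prodC_succ,
      ← Ideal.span_singleton_mul_span_singleton, ← add_assoc]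
    refine (Ideal.mul_mono_right (idealC_le hn d (by omega))).trans ?_
    rw [mul_add]
    refine add_le_add ((Ideal.mul_mono_left ih).trans ?_) le_rfl
    rw [add_mul]
    exact add_le_add le_rfl Ideal.mul_le_left

/-! ### The common part and the inductive step. -/

/-- The part of the claimed intersection `p_1 ∩ ⋯ ∩ p_r` that lies in every `p_t`, `t > r`. -/
noncomputable def commonPart (k : Type*) [Field k] {n : ℕ} (hn : 2 ≤ n) (d r : ℕ) :
    Ideal (PolyRing k n) :=
  idealE k hn d + idealD k hn d 0 + idealC k n 1 * idealF k hn d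
    + ∑ i ∈ Finset.range r, prodC k n i * (idealD k hn d (i + 1) + idealB k n i)

theorem commonPart_succ (hn : 2 ≤ n) (d r : ℕ) :
    commonPart k hn d (r + 1) = commonPart k hn d r
      + prodC k n r * (idealD k hn d (r + 1) + idealB k n r) := by
  rw [commonPart, Finset.sum_range_succ, ← add_assoc, commonPart]

theorem idealE_le_commonPart (hn : 2 ≤ n) (d r : ℕ) : idealE k hn d ≤ commonPart k hn d r :=
  le_sup_left.trans (le_sup_left.trans le_sup_left)

theorem idealD_zero_le_commonPart (hn : 2 ≤ n) (d r : ℕ) :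
    idealD k hn d 0 ≤ commonPart k hn d r :=
  le_sup_right.trans (le_sup_left.trans le_sup_left)

theorem idealC_mul_idealF_le_commonPart (hn : 2 ≤ n) (d r : ℕ) :
    idealC k n 1 * idealF k hn d ≤ commonPart k hn d r :=
  le_sup_right.trans le_sup_left

theorem prodC_mul_le_commonPart (hn : 2 ≤ n) (d : ℕ) {i r : ℕ} (hi : i < r) :
    prodC k n i * (idealD k hn d (i + 1) + idealB k n i) ≤ commonPart k hn d r :=
  (Finset.single_le_sum (f := fun i => prodC k n i * (idealD k hn d (i + 1) + idealB k n i))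
    (fun _ _ => bot_le) (Finset.mem_range.2 hi)).trans le_sup_right

theorem prodC_mul_idealD_le_commonPart (hn : 2 ≤ n) (d : ℕ) {i r : ℕ} (hi : i ≤ r) :
    prodC k n r * idealD k hn d i ≤ commonPart k hn d r := by
  cases i with
  | zero => exact Ideal.mul_le_right.trans (idealD_zero_le_commonPart hn d r)
  | succ i =>
    exact (Ideal.mul_mono (prodC_antitone (by omega)) le_sup_left).trans
      (prodC_mul_le_commonPart hn d (by omega))

theorem prodC_le_span_add_commonPart (hn : 2 ≤ n) (d r : ℕ) :
    prodC k n r ≤ Ideal.span {∏ j ∈ Finset.Icc 1 r, cHead k n j} + commonPart k hn d r :=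
  (prodC_le_span_add hn d r).trans <| add_le_add le_rfl <|
    (Finset.sum_le_sum fun _ _ => Ideal.mul_mono_right le_sup_left).trans le_sup_right

/-- Cancel one variable at a time; the bound r + 2 ≤ n keeps every `cHead` a genuine variable, not
the default 0. -/
theorem mem_idealP_of_prod_cHead_mul_mem (hn : 2 ≤ n) (d : ℕ) {r t : ℕ} (ht : t ≤ r + 1)
    (hr : r + 2 ≤ n) {a : PolyRing k n}
    (ha : (∏ j ∈ Finset.Icc 1 t, cHead k n j) * a ∈ idealP k hn d (r + 2)) :
    a ∈ idealP k hn d (r + 2) := by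
  induction t with
  | zero => simpa using ha
  | succ t ih =>
    rw [Finset.prod_Icc_succ_top (by omega), mul_comm (∏ _ ∈ _, _), mul_assoc, cHead,
      dif_pos (by omega)] at ha
    exact ih (by omega) (mem_idealP_of_c_mul_mem hn d (by omega) ht _ ha)

theorem commonPart_le_idealP (hn : 2 ≤ n) (d : ℕ) {r t : ℕ} (hrt : r < t) (ht : 2 ≤ t) :
    commonPart k hn d r ≤ idealP k hn d t := by
  obtain ⟨t, rfl⟩ := Nat.exists_eq_add_of_le' ht
  have hD {j : ℕ} (hj : j < t + 2) : idealD k hn d j ≤ idealP k hn d (t + 2) :=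
    (idealD_le_sum hn d hj).trans le_sup_right
  have hB : idealB k n (t + 1) ≤ idealP k hn d (t + 2) := le_sup_right.trans le_sup_left
  have hF : idealF k hn d ≤ idealP k hn d (t + 2) :=
    le_sup_right.trans (le_sup_left.trans le_sup_left)
  have hE : idealE k hn d ≤ idealP k hn d (t + 2) :=
    le_sup_right.trans (le_sup_left.trans (le_sup_left.trans le_sup_left))
  refine sup_le (sup_le (sup_le hE (hD (by omega))) (Ideal.mul_le_right.trans hF)) ?_
  refine Finset.sum_induction _ (fun I : Ideal (PolyRing k n) => I ≤ idealP k hn d (t + 2))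
    (fun _ _ => sup_le) bot_le fun i hi => ?_
  rw [Finset.mem_range] at hi
  exact Ideal.mul_le_right.trans (sup_le (hD (by omega)) ((idealB_mono (by omega)).trans hB))

/-- With m in C_1⋯C_{r+1}: C_{r+2} extends the product, F is caught by C_1 F, B_{r+1} by the new
summand of the common part, and D_i for i ≥ 1 by C_1⋯C_{i-1} D_i. -/
theorem span_prod_mul_idealP_le (hn : 2 ≤ n) (d r : ℕ) :
    Ideal.span {∏ j ∈ Finset.Icc 1 (r + 1), cHead k n j} * idealP k hn d (r + 2)
      ≤ commonPart k hn d (r + 2) + prodC k n (r + 2) := by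
  have hm : Ideal.span {∏ j ∈ Finset.Icc 1 (r + 1), cHead k n j} ≤ prodC k n (r + 1) := by
    rw [Ideal.span_singleton_le_iff_mem]
    exact Ideal.prod_mem_prod fun j _ => cHead_mem_idealC j
  refine (Ideal.mul_mono_left hm).trans ?_
  rw [idealP]
  simp only [mul_add, Finset.mul_sum]
  have hK : commonPart k hn d (r + 1) ≤ commonPart k hn d (r + 2) + prodC k n (r + 2) := by
    rw [commonPart_succ hn d (r + 1)]
    exact le_sup_left.trans le_sup_left
  refine sup_le (sup_le (sup_le (sup_le ?_ ?_) ?_) ?_) ?_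
  · rw [← prodC_succ]
    exact le_sup_right
  · exact Ideal.mul_le_right.trans ((idealE_le_commonPart hn d _).trans hK)
  · refine (Ideal.mul_mono_left ?_).trans ((idealC_mul_idealF_le_commonPart hn d _).trans hK)
    exact (prodC_antitone (by omega)).trans_eq prodC_one
  · exact (Ideal.mul_mono_right le_sup_right).trans
      ((prodC_mul_le_commonPart hn d (by omega)).trans le_sup_left)
  · refine Finset.sum_induction _
      (fun I : Ideal (PolyRing k n) => I ≤ commonPart k hn d (r + 2) + prodC k n (r + 2))
      (fun _ _ => sup_le) bot_le fun i hi => ?_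
    rw [Finset.mem_range] at hi
    exact (prodC_mul_idealD_le_commonPart hn d (by omega)).trans hK

theorem commonPart_add_prodC_inf_idealP (hn : 2 ≤ n) (d : ℕ) {r : ℕ} (hr : r + 2 ≤ n) :
    (commonPart k hn d (r + 1) + prodC k n (r + 1)) ⊓ idealP k hn d (r + 2)
      = commonPart k hn d (r + 2) + prodC k n (r + 2) := by
  have hK : commonPart k hn d (r + 1) ≤ idealP k hn d (r + 2) :=
    commonPart_le_idealP hn d (by omega) (by omega)
  have hC : idealC k n (r + 2) ≤ idealP k hn d (r + 2) :=
    le_sup_left.trans (le_sup_left.trans (le_sup_left.trans le_sup_left))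
  have hB : idealB k n (r + 1) ≤ idealP k hn d (r + 2) := le_sup_right.trans le_sup_left
  apply le_antisymm
  · intro x hx_inf
    obtain ⟨hx, hxp⟩ := Submodule.mem_inf.1 hx_inf
    have hx' : x ∈ Ideal.span {∏ j ∈ Finset.Icc 1 (r + 1), cHead k n j}
        + commonPart k hn d (r + 1) :=
      sup_le le_sup_right (prodC_le_span_add_commonPart hn d (r + 1)) hx
    obtain ⟨u, hu, v, hv, rfl⟩ := Submodule.mem_sup.1 hx'
    obtain ⟨a, rfl⟩ := Ideal.mem_span_singleton'.1 hu
    -- Subtracting v, which lies in p_{r+2}, leaves m a in p_{r+2}; then m cancels.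
    have ha : a ∈ idealP k hn d (r + 2) := by
      refine mem_idealP_of_prod_cHead_mul_mem hn d le_rfl hr ?_
      rw [mul_comm]
      exact ((idealP k hn d (r + 2)).add_mem_iff_left (hK hv)).1 hxp
    refine Ideal.add_mem _ ?_ ?_
    · rw [mul_comm]
      exact span_prod_mul_idealP_le hn d r
        (Ideal.mul_mem_mul (Ideal.mem_span_singleton_self _) ha)
    · rw [commonPart_succ hn d (r + 1)]
      exact (le_sup_left.trans le_sup_left : commonPart k hn d (r + 1) ≤ _) hv
  · rw [commonPart_succ hn d (r + 1)]
    refine sup_le (sup_le (le_inf le_sup_left hK) (le_inf ?_ ?_)) (le_inf ?_ ?_)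
    · exact Ideal.mul_le_left.trans le_sup_right
    · exact Ideal.mul_le_right.trans
        (sup_le ((idealD_le_idealC hn d (by omega)).trans hC) hB)
    · exact (prodC_antitone (by omega)).trans le_sup_right
    · rw [prodC_succ]
      exact Ideal.mul_le_right.trans hC

/-- At r = 1 the extra terms C_1 F and D_1 are swallowed by C_1, and B_0 = 0. -/
theorem idealP_one (hn : 2 ≤ n) (d : ℕ) :
    idealP k hn d 1 = commonPart k hn d 1 + prodC k n 1 := by
  rw [prodC_one]
  apply le_antisymm
  · exact sup_le (sup_le le_sup_right ((idealE_le_commonPart hn d 1).trans le_sup_left))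
      ((idealD_zero_le_commonPart hn d 1).trans le_sup_left)
  · have hC : idealC k n 1 ≤ idealP k hn d 1 := le_sup_left.trans le_sup_left
    refine sup_le (sup_le (sup_le (sup_le ?_ le_sup_right) (Ideal.mul_le_left.trans hC)) ?_) hC
    · exact le_sup_right.trans le_sup_left
    · rw [Finset.sum_range_one]
      refine Ideal.mul_le_right.trans (sup_le ((idealD_le_idealC hn d le_rfl).trans hC) ?_)
      exact (idealB_mono zero_le_one).trans (idealB_one.trans_le bot_le)

theorem iInf_idealP (hn : 2 ≤ n) (d : ℕ) {r : ℕ} (hr : r + 1 ≤ n) :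
    (⨅ j ∈ Finset.Icc 1 (r + 1), idealP k hn d j)
      = commonPart k hn d (r + 1) + prodC k n (r + 1) := by
  induction r with
  | zero => simp only [zero_add, Finset.Icc_self, Finset.mem_singleton, iInf_iInf_eq_left,
      idealP_one]
  | succ r ih =>
    rw [← Finset.insert_Icc_right_eq_Icc_add_one (by omega), Finset.iInf_insert,
      ih (by omega), inf_comm]
    exact commonPart_add_prodC_inf_idealP hn d hr

end MayrMeyer

theorem lemma2p1 (k : Type*) [Field k] (n d : ℕ) (hn : 2 ≤ n) (hd : 2 ≤ d)
    (r : ℕ) (hr : 2 ≤ r) (hrn : r ≤ n) :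
    (⨅ j ∈ Finset.Icc 1 r, MayrMeyer.idealP k hn d j) =
      MayrMeyer.idealE k hn d + MayrMeyer.idealD k hn d 0
        + MayrMeyer.idealC k n 1 * MayrMeyer.idealF k hn d
        + ∑ i ∈ Finset.range r,
            (∏ j ∈ Finset.Icc 1 i, MayrMeyer.idealC k n j)
              * (MayrMeyer.idealD k hn d (i + 1) + MayrMeyer.idealB k n i)
        + ∏ j ∈ Finset.Icc 1 r, MayrMeyer.idealC k n j := by
  obtain ⟨r, rfl⟩ := Nat.exists_eq_add_of_le' (one_le_two.trans hr)
  exact MayrMeyer.iInf_idealP hn d hrn
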